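/- Let $k$ be a field, $n\ge 1$, $m\ge 0$, and let $D_n\subset\{a_1,b_1,\dots,a_n,b_n\}^*$ be the Dyck language of words balanced in $n$ kinds of parentheses, where $a_i$ is the opening and $b_i$ the closing parenthesis of the $i$-th kind (the empty word included). Let $\phi:\{a_1,b_1,\dots,a_n,b_n\}^*\to\{t_1,\dots,t_m\}^*$ be a monoid homomorphism and $L=\phi(D_n)$. Let $X$ be the set of letters $a_i,b_i,a_i^j,b_i^j,x,e,y,t_k$ ($1\le i,j\le n$, $1\le k\le m$), and let $R\subset k\langle X\rangle$ be the set of the following elements, for all $i,j,l\in\{1,\dots,n\}$: (i) $a_i^i x-xa_i^i$, $\ b_1^1x-xe$; (ii) $a_i^ja_l-a_ia_l^j$, $\ a_i^jb_l-a_ib_l^j$, $\ b_i^ja_l-b_ia_l^j$, $\ b_i^jb_l-b_ib_l^j$, $\ a_i^je-a_ib_j$, $\ b_i^je-b_ib_j$; (iii) $a_iy-y\phi(a_i)$, $\ b_iy-y\phi(b_i)$, $\ a_i^jy$, $\ b_i^jy$; (iv) $xye$. Let $D\ge 1$ be an integer such that all the words $\phi(a_i),\phi(b_i)$ have length at most $D$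 (for instance the maximum of these lengths, if it is not $0$). Give each $t_k$ degree $1$ and every other letter degree $D$, let the degree of a word be the sum of the degrees of its letters, and order $X^*$ by deglex (compare degrees first, then lexicographically from the left) for any total order of $X$ such that $a_\bullet^\bullet>b_\bullet^\bullet>a_\bullet>b_\bullet>e>x>y>t_\bullet$ (the order inside each group of letters is arbitrary). A subset $U$ of a two-sided ideal $I$ of $k\langle X\rangle$ is a Gröbner–Shirshov basis of $I$ if the leading monomials of its nonzero elements generate the monomial ideal generated by the leading monomials of all nonzero elements of $I$. It is minimal if these leading monomials form a minimal generating set of that monomial ideal, $0\notin U$, and distinct elements of $U$ have distinct leading monomials. It is reduced if its elements are monic and no non-leading word of an element of $U$ contains the leading monomial of an element of $U$ as a subword. Then the set $$\{\text{relations (i)--(iii)}\}\ \cup\ xP_nyLe,\qquad P_n=(D_ne)^*,$$ is a minimal Gröbner–Shirshov basis of the two-sided ideal of $k\langle X\rangle$ generated by $R$, and it is reduced. The union is disjoint, and the set of monomials $xP_nyLe$ is infinite. Moreover, $P_n$ consists of the words $e^{i_0}w_1e^{i_1}\cdots w_se^{i_s}$ with $s,i_0\ge 0$, $i_1,\dots,i_s>0$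 and $w_1,\dots,w_s\in D_n$ (the empty word being the case $s=i_0=0$). -/

import Mathlib

noncomputable section

namespace GSDyck

/-! ### Noncommutative Gröbner–Shirshov bases

The free associative algebra `k⟨X⟩` is the monoid algebra of the free monoid `X^*`. -/

section GS

variable {X k : Type*} [Field k]

/-- The free associative algebra `k⟨X⟩`, with basis the words in `X`. -/
abbrev FreeAlg (k X : Type*) [Field k] : Type _ := MonoidAlgebra k (FreeMonoid X)

/-- A word, given as a list of letters, as an element of `k⟨X⟩`. -/
def word (k : Type*) [Field k] (l : List X) : FreeAlg k X :=
  MonoidAlgebra.single (FreeMonoid.ofList l) 1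

/-- `w` is the leading monomial of `f` (which is then nonzero) for the ordering `lt` of words. -/
def IsLeadingMonomial (lt : FreeMonoid X → FreeMonoid X → Prop) (f : FreeAlg k X)
    (w : FreeMonoid X) : Prop :=
  f.coeff w ≠ 0 ∧ ∀ v, f.coeff v ≠ 0 → v ≠ w → lt v w

/-- The set of leading monomials of the nonzero elements of `S`. -/
def leadingMonomials (lt : FreeMonoid X → FreeMonoid X → Prop) (S : Set (FreeAlg k X)) :
    Set (FreeMonoid X) :=
  {w | ∃ f ∈ S, IsLeadingMonomial lt f w}

/-- The two-sided ideal of `k⟨X⟩` generated by a set of words. -/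
def monomialIdeal (k : Type*) [Field k] (W : Set (FreeMonoid X)) : TwoSidedIdeal (FreeAlg k X) :=
  TwoSidedIdeal.span ((fun w => (MonoidAlgebra.single w 1 : FreeAlg k X)) '' W)

/-- The leading monomial ideal of `I`. -/
def leadingIdeal (lt : FreeMonoid X → FreeMonoid X → Prop) (I : TwoSidedIdeal (FreeAlg k X)) :
    TwoSidedIdeal (FreeAlg k X) :=
  monomialIdeal k (leadingMonomials lt (I : Set (FreeAlg k X)))

/-- `U` is a Gröbner–Shirshov basis of `I`: it lies in `I`, and its leading monomials generate
the leading monomial ideal of `I`. -/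
structure IsGSBasis (lt : FreeMonoid X → FreeMonoid X → Prop) (U : Set (FreeAlg k X))
    (I : TwoSidedIdeal (FreeAlg k X)) : Prop where
  subset : U ⊆ (I : Set (FreeAlg k X))
  generates : monomialIdeal k (leadingMonomials lt U) = leadingIdeal lt I

/-- A minimal GS-basis: no element is superfluous, that is, the leading monomials form a minimal
generating set of the leading monomial ideal, and (no repetitions) `0` is not in the basis and
distinct elements have distinct leading monomials. -/
structure IsMinimalGSBasis (lt : FreeMonoid X → FreeMonoid X → Prop) (U : Set (FreeAlg k X))
    (I : TwoSidedIdeal (FreeAlg k X)) : Prop extends IsGSBasis lt U I where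
  minimal : ∀ W, W ⊂ leadingMonomials lt U → monomialIdeal k W ≠ leadingIdeal lt I
  zero_notMem : (0 : FreeAlg k X) ∉ U
  injective : ∀ f ∈ U, ∀ g ∈ U, ∀ w,
    IsLeadingMonomial lt f w → IsLeadingMonomial lt g w → f = g

/-- `U` is reduced: its elements are monic, and no non-leading word of an element of `U` contains
a leading monomial of `U` as a subword. -/
def IsReduced (lt : FreeMonoid X → FreeMonoid X → Prop) (U : Set (FreeAlg k X)) : Prop :=
  ∀ f ∈ U, ∀ w, IsLeadingMonomial lt f w →
    f.coeff w = 1 ∧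
    ∀ v, f.coeff v ≠ 0 → v ≠ w → ∀ u ∈ leadingMonomials lt U, ∀ p q, v ≠ p * u * q

end GS

/-! ### The Dyck language and its homomorphic images -/

/-- The parentheses `a_i` (opening) and `b_i` (closing) of `n` kinds. -/
inductive Paren (n : ℕ) : Type
  | a (i : Fin n)
  | b (i : Fin n)

/-- Balanced words in `n` kinds of parentheses. -/
inductive IsDyck {n : ℕ} : List (Paren n) → Prop
  | nil : IsDyck []
  | cons (i : Fin n) (w w' : List (Paren n)) (hw : IsDyck w) (hw' : IsDyck w') :
      IsDyck (Paren.a i :: w ++ Paren.b i :: w')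

/-- The Dyck language `D_n`. -/
def dyck (n : ℕ) : Language (Paren n) := {w | IsDyck w}

/-- The language `L = φ(D_n)`. -/
def dyckImage {n m : ℕ} (φ : FreeMonoid (Paren n) →* FreeMonoid (Fin m)) : Language (Fin m) :=
  {v | ∃ w ∈ dyck n, (φ (FreeMonoid.ofList w)).toList = v}

/-! ### The algebra -/

/-- The generators: `br (a i)`, `br (b i)` are `a_i`, `b_i`; `up (a i) j`, `up (b i) j` are
`a_i^j`, `b_i^j`; and further `x`, `e`, `y`, `t_k`. -/
inductive Letter (n m : ℕ) : Type
  | br (c : Paren n)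
  | up (c : Paren n) (j : Fin n)
  | x
  | e
  | y
  | t (k : Fin m)

open Letter Paren

/-- Position of the group of a letter in `a_•^• > b_•^• > a_• > b_• > e > x > y > t_•`. -/
def rank {n m : ℕ} : Letter n m → ℕ
  | up (a _) _ => 7
  | up (b _) _ => 6
  | br (a _) => 5
  | br (b _) => 4
  | e => 3
  | x => 2
  | y => 1
  | t _ => 0

/-- The degree of a letter: `1` for the `t_k` and `D` for all other letters. -/
def letterDeg {n m : ℕ} (D : ℕ) : Letter n m → ℕ
  | t _ => 1
  | _ => D

/-- The degree of a word. -/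
def wordDeg {n m : ℕ} (D : ℕ) (w : FreeMonoid (Letter n m)) : ℕ :=
  (w.toList.map (letterDeg D)).sum

/-- The deglex ordering of words: compare degrees first, then lexicographically from the left. -/
def degLex {n m : ℕ} [LinearOrder (Letter n m)] (D : ℕ) (u v : FreeMonoid (Letter n m)) : Prop :=
  wordDeg D u < wordDeg D v ∨ (wordDeg D u = wordDeg D v ∧ List.Lex (· < ·) u.toList v.toList)

section Relations

variable (k : Type*) [Field k] {n m : ℕ}

/-- Relations (i): `a_i^i x - x a_i^i` and `b_1^1 x - x e`. -/
def relI [NeZero n] : Set (FreeAlg k (Letter n m)) :=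
  {f | (∃ i : Fin n, f = word k [up (a i) i, x] - word k [x, up (a i) i]) ∨
    f = word k [up (b 0) 0, x] - word k [x, e]}

/-- Relations (ii): `c^j c' - c c'^j` and `c^j e - c b_j`, where `c`, `c'` run over all the
`a_i`, `b_i`. -/
def relII : Set (FreeAlg k (Letter n m)) :=
  {f | (∃ (c c' : Paren n) (j : Fin n), f = word k [up c j, br c'] - word k [br c, up c' j]) ∨
    ∃ (c : Paren n) (j : Fin n), f = word k [up c j, e] - word k [br c, br (b j)]}

/-- Relations (iii): `c y - y φ(c)` and `c^j y`, where `c` runs over all the `a_i`, `b_i`. -/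
def relIII (φ : FreeMonoid (Paren n) →* FreeMonoid (Fin m)) : Set (FreeAlg k (Letter n m)) :=
  {f | (∃ c : Paren n,
      f = word k [br c, y] - word k (y :: (φ (FreeMonoid.of c)).toList.map t)) ∨
    ∃ (c : Paren n) (j : Fin n), f = word k [up c j, y]}

/-- Relation (iv): `x y e`. -/
def relIV : Set (FreeAlg k (Letter n m)) := {word k [x, y, e]}

end Relations

/-- The language `P_n = (D_n e)^*`. -/
def langP (n m : ℕ) : Language (Letter n m) :=
  KStar.kstar (Language.map br (dyck n) * {[e]})

/-- The words `e^{i_0} w_1 e^{i_1} ⋯ w_s e^{i_s}` with `s, i_0 ≥ 0`, `i_1, …, i_s > 0` and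
`w_1, …, w_s ∈ D_n`; the list `l` consists of the pairs `(w_1, i_1), …, (w_s, i_s)`. -/
def explicitP (n m : ℕ) : Language (Letter n m) :=
  {u | ∃ (i₀ : ℕ) (l : List (List (Paren n) × ℕ)), (∀ q ∈ l, q.1 ∈ dyck n ∧ 0 < q.2) ∧
    u = List.replicate i₀ e ++ l.flatMap (fun q => q.1.map br ++ List.replicate q.2 e)}

/-- The language `x P_n y L e` with `L = φ(D_n)`. -/
def langG {n m : ℕ} (φ : FreeMonoid (Paren n) →* FreeMonoid (Fin m)) : Language (Letter n m) :=
  {[x]} * langP n m * {[y]} * Language.map t (dyckImage φ) * {[e]}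

end GSDyck

end

noncomputable section

namespace GSDyck

/-! ### Leading monomials of words and of differences of two words -/

section Words

variable {X k : Type*} [Field k]

/-! Two facts carry the theorem: the words of `x P_n y L e` lie in the ideal `I`, and every leading
monomial of `I` contains one of the claimed leading words.

Membership starts from `x y e`. If `x q y e` lies in `I`, then `b_1^1 x = x e` puts `x e q y e` in
`I`. If `q = w e q'` with `w` a Dyck word, multiply by `a_i^i`: it passes `x`, its upper index
travels along `w` by (ii) and turns `e` into `b_i`, giving `x a_i w b_i q' y e`. These moves reach
every `q` in `P_n D_n` (`IsDyckPath.word_mem`), and (iii) pushes the final Dyck factor through `y`,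
where it becomes a word of `L`.

For the converse no compositions are resolved. The algebra `k⟨X⟩` acts on the span of all words,
each letter by left multiplication followed by reduction, with `x` killing the words that have a
prefix in `P_n y L e`. The relations act as zero (`Rule.actWord_eq`); the crux is that if `x` kills
`v`, then `a_i^i v` is zero or again killed (`KilledByX.opUp_bind_opX`). A word sends the empty word
to zero, to itself or to a smaller word (`actWord_le`), and to itself if it contains no claimed
leading word (`actWord_eq_self`). If the leading monomial `w` of some `f` in `I` contained none,
then `f` applied to the empty word would have a nonzero coefficient at `w`, although `f` acts as
zero.

Minimality and reducedness come from comparing the letters of the words involved. -/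

theorem word_append (l l' : List X) : word k (l ++ l') = word k l * word k l' := by
  simp [word, MonoidAlgebra.single_mul_single]

theorem word_injective : Function.Injective (word k : List X → FreeAlg k X) := by
  intro l l' h
  exact FreeMonoid.ofList.injective
    (MonoidAlgebra.of_injective (R := k) (M := FreeMonoid X) h)

open Classical in
theorem coeff_word (l : List X) (v : FreeMonoid X) :
    (word k l).coeff v = if FreeMonoid.ofList l = v then 1 else 0 := by
  simp [word, Finsupp.single_apply]

theorem isLeadingMonomial_word_iff {lt : FreeMonoid X → FreeMonoid X → Prop} {l : List X}
    {w : FreeMonoid X} : IsLeadingMonomial lt (word k l) w ↔ w = FreeMonoid.ofList l := by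
  classical
  simp only [IsLeadingMonomial, coeff_word]
  constructor
  · rintro ⟨h, -⟩
    by_contra hne
    exact h (if_neg fun h' => hne h'.symm)
  · intro hw
    rw [hw]
    refine ⟨by simp, fun v hv hne => absurd (if_neg fun h => hne h.symm) hv⟩

theorem isLeadingMonomial_word_sub_word_iff {lt : FreeMonoid X → FreeMonoid X → Prop}
    (asymm : ∀ u v, lt u v → ¬ lt v u) {l l' : List X}
    (h : lt (FreeMonoid.ofList l') (FreeMonoid.ofList l)) {w : FreeMonoid X} :
    IsLeadingMonomial lt (word k l - word k l') w ↔ w = FreeMonoid.ofList l := by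
  classical
  have hne : FreeMonoid.ofList l' ≠ FreeMonoid.ofList l := by
    intro he
    rw [he] at h
    exact asymm _ _ h h
  simp only [IsLeadingMonomial, MonoidAlgebra.coeff_sub, Finsupp.sub_apply, coeff_word]
  constructor
  · rintro ⟨hw, hmax⟩
    by_contra hwl
    have hwl' : w = FreeMonoid.ofList l' := by
      by_contra hwl'
      exact hw (by rw [if_neg (Ne.symm hwl), if_neg (Ne.symm hwl'), sub_zero])
    subst hwl'
    exact asymm _ _ h (hmax (FreeMonoid.ofList l) (by simp [hne]) (Ne.symm hwl))
  · intro hw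
    rw [hw]
    refine ⟨by simp [hne], fun v hv hvl => ?_⟩
    have : FreeMonoid.ofList l' = v := by
      by_contra hvl'
      exact hv (by rw [if_neg (Ne.symm hvl), if_neg hvl', sub_zero])
    exact this ▸ h

theorem coeff_word_sub_word_eq_one {l l' : List X} (h : l' ≠ l) :
    (word k l - word k l').coeff (FreeMonoid.ofList l) = 1 := by
  classical
  simp [coeff_word, h]

theorem eq_or_eq_of_coeff_word_sub_word_ne_zero {l l' : List X} {v : FreeMonoid X}
    (h : (word k l - word k l').coeff v ≠ 0) :
    v = FreeMonoid.ofList l ∨ v = FreeMonoid.ofList l' := by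
  classical
  by_contra! hv
  apply h
  rw [MonoidAlgebra.coeff_sub, Finsupp.sub_apply, coeff_word, coeff_word, if_neg hv.1.symm,
    if_neg hv.2.symm, sub_zero]

end Words

/-! ### Monomial ideals and criteria for Gröbner–Shirshov bases -/

section MonomialIdeal

variable {X k : Type*} [Field k] {W : Set (FreeMonoid X)}

theorem exists_coeff_ne_zero_of_mul {f g : FreeAlg k X} {v : FreeMonoid X}
    (h : (f * g).coeff v ≠ 0) : ∃ p q, f.coeff p ≠ 0 ∧ g.coeff q ≠ 0 ∧ v = p * q := by
  classical
  by_contra! hv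
  apply h
  rw [MonoidAlgebra.coeff_mul]
  refine Finset.sum_eq_zero fun p hp => Finset.sum_eq_zero fun q hq => if_neg fun hpq => ?_
  exact hv p q (Finsupp.mem_support_iff.1 hp) (Finsupp.mem_support_iff.1 hq) hpq.symm

/-- The elements all of whose words contain a word of `W` form a two-sided ideal. -/
theorem exists_subword_of_mem_monomialIdeal {f : FreeAlg k X} (hf : f ∈ monomialIdeal k W)
    {v : FreeMonoid X} (hv : f.coeff v ≠ 0) : ∃ u ∈ W, ∃ p q, v = p * u * q := by
  classical
  revert v
  refine TwoSidedIdeal.span_induction (p := fun f _ => ∀ {v : FreeMonoid X}, f.coeff v ≠ 0 →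
    ∃ u ∈ W, ∃ p q, v = p * u * q) ?_ ?_ ?_ ?_ ?_ ?_ hf
  · rintro _ ⟨u, hu, rfl⟩ v hv
    refine ⟨u, hu, 1, 1, ?_⟩
    simp only [MonoidAlgebra.coeff_single, Finsupp.single_apply] at hv
    simpa using (by_contra fun h => hv (if_neg h) : u = v).symm
  · intro v hv
    simp at hv
  · intro f g _ _ ihf ihg v hv
    by_cases h : f.coeff v = 0
    · exact ihg (by simpa [h] using hv)
    · exact ihf h
  · intro f _ ih v hv
    exact ih (by simpa using hv)
  · intro a f _ ih v hv
    obtain ⟨p, q, -, hq, rfl⟩ := exists_coeff_ne_zero_of_mul hv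
    obtain ⟨u, hu, p', q', rfl⟩ := ih hq
    exact ⟨u, hu, p * p', q', by simp [mul_assoc]⟩
  · intro a f _ ih v hv
    obtain ⟨p, q, hp, -, rfl⟩ := exists_coeff_ne_zero_of_mul hv
    obtain ⟨u, hu, p', q', rfl⟩ := ih hp
    exact ⟨u, hu, p', q' * q, by simp [mul_assoc]⟩

theorem single_mem_monomialIdeal {u : FreeMonoid X} (hu : u ∈ W) (p q : FreeMonoid X) :
    (MonoidAlgebra.single (p * u * q) 1 : FreeAlg k X) ∈ monomialIdeal k W := by
  have h : (MonoidAlgebra.single u 1 : FreeAlg k X) ∈ monomialIdeal k W :=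
    TwoSidedIdeal.subset_span ⟨u, hu, rfl⟩
  have := TwoSidedIdeal.mul_mem_right _ _ (MonoidAlgebra.single q 1 : FreeAlg k X)
    (TwoSidedIdeal.mul_mem_left _ (MonoidAlgebra.single p 1 : FreeAlg k X) _ h)
  simpa [MonoidAlgebra.single_mul_single] using this

/-- A subset of an ideal is a GS-basis if the leading monomial of every element of the ideal
contains a leading monomial of the subset. -/
theorem IsGSBasis.of_exists_subword {lt : FreeMonoid X → FreeMonoid X → Prop}
    {U : Set (FreeAlg k X)} {I : TwoSidedIdeal (FreeAlg k X)} (hU : U ⊆ (I : Set (FreeAlg k X)))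
    (h : ∀ f ∈ I, ∀ w, IsLeadingMonomial lt f w →
      ∃ u ∈ leadingMonomials lt U, ∃ p q, w = p * u * q) : IsGSBasis lt U I where
  subset := hU
  generates := by
    apply le_antisymm
    · refine TwoSidedIdeal.span_mono (Set.image_mono ?_)
      rintro w ⟨f, hf, hw⟩
      exact ⟨f, hU hf, hw⟩
    · refine TwoSidedIdeal.span_le.2 ?_
      rintro _ ⟨w, ⟨f, hf, hw⟩, rfl⟩
      obtain ⟨u, hu, p, q, rfl⟩ := h f hf w hw
      exact single_mem_monomialIdeal hu p q

/-- If the leading monomials of a GS-basis do not contain one another, then no proper subset of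
them generates the leading monomial ideal. -/
theorem IsGSBasis.monomialIdeal_ne_of_ssubset {lt : FreeMonoid X → FreeMonoid X → Prop}
    {U : Set (FreeAlg k X)} {I : TwoSidedIdeal (FreeAlg k X)} (hU : IsGSBasis lt U I)
    (h : ∀ u ∈ leadingMonomials lt U, ∀ v ∈ leadingMonomials lt U, ∀ p q, v = p * u * q → u = v)
    (hW : W ⊂ leadingMonomials lt U) : monomialIdeal k W ≠ leadingIdeal lt I := by
  classical
  intro he
  obtain ⟨v, hv, hvW⟩ := Set.exists_of_ssubset hW
  have hmem : (MonoidAlgebra.single v 1 : FreeAlg k X) ∈ monomialIdeal k W := by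
    rw [he, ← hU.generates]
    exact TwoSidedIdeal.subset_span ⟨v, hv, rfl⟩
  obtain ⟨u, hu, p, q, hvu⟩ := exists_subword_of_mem_monomialIdeal hmem (v := v) (by simp)
  exact hvW (h u (hW.subset hu) v hv p q hvu ▸ hu)

end MonomialIdeal

/-! ### Representations by partial operators on words -/

section Action

variable {X : Type*} (k : Type*) [Field k] (op : X → List X → Option (List X))

/-- The action of words on words generated by partial operators `op`, one for each letter. -/
def actWord (w v : List X) : Option (List X) :=
  w.foldr (fun l o => o.bind (op l)) (some v)

@[simp]
theorem actWord_nil (v : List X) : actWord op [] v = some v := rfl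

@[simp]
theorem actWord_cons (l : X) (w v : List X) :
    actWord op (l :: w) v = (actWord op w v).bind (op l) := rfl

/-- The basis vector of a word, and zero for an undefined word. -/
def optionSingle (o : Option (List X)) : List X →₀ k :=
  o.elim 0 fun v => Finsupp.single v 1

/-- The representation of the free algebra on the vector space spanned by the words that is given
by partial operators `op`, undefined values being zero. -/
def opRep : FreeAlg k X →ₐ[k] Module.End k (List X →₀ k) :=
  MonoidAlgebra.lift k _ _ (FreeMonoid.lift fun l =>
    Finsupp.linearCombination k fun v => optionSingle k (op l v))

theorem opRep_single_apply (w : FreeMonoid X) (c : k) (v : List X) :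
    opRep k op (MonoidAlgebra.single w c) (Finsupp.single v 1) =
      c • optionSingle k (actWord op w.toList v) := by
  rw [opRep, MonoidAlgebra.lift_single, LinearMap.smul_apply]
  congr 1
  induction w using FreeMonoid.inductionOn' with
  | one => simp [optionSingle]
  | of_mul l w ih =>
    rw [map_mul, Module.End.mul_apply, ih, FreeMonoid.lift_eval_of]
    simp only [FreeMonoid.toList_mul, FreeMonoid.toList_of, List.singleton_append, actWord_cons]
    cases actWord op w.toList v <;> simp [optionSingle]

variable {k op}

theorem opRep_word_sub_word_eq_zero {l l' : List X} (h : ∀ v, actWord op l v = actWord op l' v) :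
    opRep k op (word k l - word k l') = 0 := by
  refine Finsupp.lhom_ext' fun v => LinearMap.ext_ring ?_
  simp [word, opRep_single_apply, h]

theorem opRep_word_eq_zero {l : List X} (h : ∀ v, actWord op l v = none) :
    opRep k op (word k l) = 0 := by
  refine Finsupp.lhom_ext' fun v => LinearMap.ext_ring ?_
  simp [word, opRep_single_apply, h, optionSingle]

/-- If partial operators satisfy the relations `R` and do not increase words, then the leading
monomials of the ideal generated by `R` are moved by the operators. -/
theorem actWord_ne_of_isLeadingMonomial {lt : FreeMonoid X → FreeMonoid X → Prop}
    (asymm : ∀ u v, lt u v → ¬ lt v u)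
    (hlt : ∀ w v, actWord op w [] = some v →
      v = w ∨ lt (FreeMonoid.ofList v) (FreeMonoid.ofList w))
    {R : Set (FreeAlg k X)} (hR : ∀ f ∈ R, opRep k op f = 0) {f : FreeAlg k X}
    (hf : f ∈ TwoSidedIdeal.span R) {w : FreeMonoid X} (hw : IsLeadingMonomial lt f w) :
    actWord op w.toList [] ≠ some w.toList := by
  classical
  intro hfix
  have hker : opRep k op f = 0 := by
    have : TwoSidedIdeal.span R ≤ TwoSidedIdeal.ker (opRep k op) :=
      TwoSidedIdeal.span_le.2 fun g hg => (TwoSidedIdeal.mem_ker _).2 (hR g hg)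
    exact (TwoSidedIdeal.mem_ker _).1 (this hf)
  -- This is the coefficient at `w` of `f` applied to the empty word.
  have hsum : f.coeff.sum (fun v c => c * optionSingle k (actWord op v.toList []) w.toList) = 0 := by
    have h := congrArg (fun T => T (Finsupp.single [] 1) w.toList) hker
    rw [← MonoidAlgebra.sum_coeff_single f, map_finsuppSum] at h
    simpa [Finsupp.sum, LinearMap.sum_apply, Finsupp.finsetSum_apply, opRep_single_apply] using h
  rw [Finsupp.sum, Finset.sum_eq_single w] at hsum
  · rw [hfix] at hsum
    exact hw.1 (by simpa [optionSingle] using hsum)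
  -- A smaller word `v` yields at most `v`, hence never `w`; only asymmetry of `lt` is needed.
  · intro v hv hvw
    have hvlt := hw.2 v (Finsupp.mem_support_iff.1 hv) hvw
    rcases hact : actWord op v.toList [] with _ | u
    · simp [optionSingle]
    · have : u ≠ w.toList := by
        rintro rfl
        rcases hlt _ _ hact with h | h
        · exact hvw (FreeMonoid.toList.injective h).symm
        · exact asymm _ _ hvlt h
      simp [optionSingle, this]
  · intro h
    exact absurd (Finsupp.mem_support_iff.2 hw.1) h

end Action

open Letter Paren

/-! ### The languages `D_n`, `P_n`, `L` and `x P_n y L e` -/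

section Languages

variable {n m : ℕ}

theorem IsDyck.append {u v : List (Paren n)} (hu : IsDyck u) (hv : IsDyck v) :
    IsDyck (u ++ v) := by
  induction hu with
  | nil => exact hv
  | cons i w w' hw hw' _ ih' => simpa using IsDyck.cons i w (w' ++ v) hw ih'

theorem nil_mem_langP : [] ∈ langP n m := Language.nil_mem_kstar _

theorem cons_mem_langP {w : List (Paren n)} (hw : IsDyck w) {p : List (Letter n m)}
    (hp : p ∈ langP n m) : w.map br ++ e :: p ∈ langP n m := by
  rw [langP, Language.mem_kstar] at hp ⊢
  obtain ⟨L, rfl, hL⟩ := hp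
  refine ⟨(w.map br ++ [e]) :: L, by simp, ?_⟩
  intro u hu
  rcases List.mem_cons.1 hu with rfl | hu
  · exact Language.mem_mul.2 ⟨_, ⟨w, hw, rfl⟩, [e], rfl, rfl⟩
  · exact hL u hu

theorem langP_induction {motive : List (Letter n m) → Prop} (nil : motive [])
    (cons : ∀ w p, IsDyck w → p ∈ langP n m → motive p → motive (w.map br ++ e :: p))
    {p : List (Letter n m)} (hp : p ∈ langP n m) : motive p := by
  rw [langP, Language.mem_kstar] at hp
  obtain ⟨L, rfl, hL⟩ := hp
  induction L with
  | nil => exact nil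
  | cons u L ih =>
    obtain ⟨_, ⟨w, hw, rfl⟩, _, rfl, rfl⟩ := Language.mem_mul.1 (hL u (by simp))
    have hL' : ∀ y ∈ L, y ∈ Language.map br (dyck n) * {[e]} := fun y hy => hL y (by simp [hy])
    have := cons w L.flatten hw (Language.join_mem_kstar hL') (ih hL')
    simpa using this

theorem langP_cases {p : List (Letter n m)} (hp : p ∈ langP n m) :
    p = [] ∨ ∃ w p', IsDyck w ∧ p' ∈ langP n m ∧ p = w.map br ++ e :: p' :=
  langP_induction (motive := fun p => p = [] ∨ ∃ w p', IsDyck w ∧ p' ∈ langP n m ∧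
    p = w.map br ++ e :: p') (Or.inl rfl) (fun w p hw hp _ => Or.inr ⟨w, p, hw, hp, rfl⟩) hp

theorem replicate_append_mem_langP (i : ℕ) {p : List (Letter n m)} (hp : p ∈ langP n m) :
    List.replicate i e ++ p ∈ langP n m := by
  induction i with
  | zero => simpa using hp
  | succ i ih => simpa [List.replicate_succ] using cons_mem_langP IsDyck.nil ih

theorem langP_eq_explicitP : langP n m = explicitP n m := by
  ext u
  constructor
  · refine langP_induction ⟨0, [], by simp, by simp⟩ ?_
    rintro w _ hw - ⟨i, l, hl, rfl⟩
    -- The new `e` merges with the initial `e^i`. Since `w` may be empty, the initial exponent can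
    -- be taken to be `0`.
    refine ⟨0, (w, i + 1) :: l, ?_, by simp [List.replicate_succ]⟩
    intro q hq
    rcases List.mem_cons.1 hq with rfl | hq
    · exact ⟨hw, Nat.succ_pos i⟩
    · exact hl q hq
  · rintro ⟨i, l, hl, rfl⟩
    refine replicate_append_mem_langP i ?_
    induction l with
    | nil => exact nil_mem_langP
    | cons q l ih =>
      obtain ⟨hq, hpos⟩ := hl q (by simp)
      obtain ⟨i, hi⟩ := Nat.exists_eq_succ_of_ne_zero hpos.ne'
      have := cons_mem_langP hq
        (replicate_append_mem_langP i (ih fun q hq => hl q (by simp [hq])))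
      simpa [hi, List.replicate_succ] using this

theorem eq_e_or_eq_br_of_mem_langP {p : List (Letter n m)} (hp : p ∈ langP n m)
    {l : Letter n m} (hl : l ∈ p) : l = e ∨ ∃ c, l = br c := by
  revert hl
  refine langP_induction (motive := fun p => l ∈ p → l = e ∨ ∃ c, l = br c) (by simp) ?_ hp
  rintro w p - - ih hl
  simp only [List.mem_append, List.mem_map, List.mem_cons] at hl
  rcases hl with ⟨c, -, rfl⟩ | rfl | hl
  · exact Or.inr ⟨c, rfl⟩
  · exact Or.inl rfl
  · exact ih hl

/-- A nonempty word of `P_n` ends in `e`. Hence no `c y` occurs in `x P_n y L e`. -/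
theorem langP_ne_append_br {p : List (Letter n m)} (hp : p ∈ langP n m) (s : List (Letter n m))
    (c : Paren n) : p ≠ s ++ [br c] := by
  have h : ∀ l ∈ p.getLast?, l = e := by
    refine langP_induction (motive := fun p => ∀ l ∈ p.getLast?, l = e) (by simp) ?_ hp
    intro w p _ _ ih l hl
    rcases eq_or_ne p [] with rfl | hne
    · simpa using hl.symm
    · apply ih
      obtain ⟨d, p, rfl⟩ := List.exists_cons_of_ne_nil hne
      simpa [List.getLast?_append, List.getLast?_cons_cons] using hl
  rintro rfl
  simpa using h (br c) (by simp)

variable (φ : FreeMonoid (Paren n) →* FreeMonoid (Fin m))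

theorem nil_mem_dyckImage : [] ∈ dyckImage φ := ⟨[], IsDyck.nil, by simp⟩

theorem append_mem_dyckImage {w : List (Paren n)} (hw : IsDyck w) {l : List (Fin m)}
    (hl : l ∈ dyckImage φ) : (φ (FreeMonoid.ofList w)).toList ++ l ∈ dyckImage φ := by
  obtain ⟨w', hw', rfl⟩ := hl
  exact ⟨w ++ w', hw.append hw', by simp [FreeMonoid.ofList_append]⟩

theorem mem_langG_iff {u : List (Letter n m)} : u ∈ langG φ ↔
    ∃ p ∈ langP n m, ∃ l ∈ dyckImage φ, u = x :: p ++ y :: (l.map t ++ [e]) := by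
  simp only [langG, Language.mem_mul]
  constructor
  · rintro ⟨_, ⟨_, ⟨_, ⟨_, rfl, p, hp, rfl⟩, _, rfl, rfl⟩, _, ⟨l, hl, rfl⟩, rfl⟩, _, rfl, rfl⟩
    exact ⟨p, hp, l, hl, by simp⟩
  · rintro ⟨p, hp, l, hl, rfl⟩
    exact ⟨_, ⟨_, ⟨_, ⟨_, rfl, p, hp, rfl⟩, _, rfl, rfl⟩, _, ⟨l, hl, rfl⟩, rfl⟩, _, rfl, by simp⟩

theorem infinite_langG : (langG φ : Set (List (Letter n m))).Infinite := by
  refine Set.infinite_of_injective_forall_mem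
    (f := fun i : ℕ => x :: List.replicate i e ++ y :: (([] : List (Fin m)).map t ++ [e])) ?_ ?_
  · intro i j h
    simpa using congrArg List.length h
  · intro i
    refine (mem_langG_iff φ).2 ⟨_, ?_, [], nil_mem_dyckImage φ, rfl⟩
    simpa using replicate_append_mem_langP i nil_mem_langP

variable {φ}

theorem x_mem_of_mem_langG {u : List (Letter n m)} (hu : u ∈ langG φ) : x ∈ u := by
  obtain ⟨p, -, q, -, rfl⟩ := (mem_langG_iff φ).1 hu
  simp

theorem y_mem_of_mem_langG {u : List (Letter n m)} (hu : u ∈ langG φ) : y ∈ u := by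
  obtain ⟨p, -, q, -, rfl⟩ := (mem_langG_iff φ).1 hu
  simp

/-- Each of `x` and `y` occurs once in such a word, so both must match; after `y`, the first `e`
ends the word. -/
theorem eq_of_infix_of_mem_langG {u v : List (Letter n m)} (hu : u ∈ langG φ) (hv : v ∈ langG φ)
    (h : u <:+: v) : u = v := by
  obtain ⟨s, r, hsr⟩ := h
  obtain ⟨p, hp, q, -, rfl⟩ := (mem_langG_iff φ).1 hu
  obtain ⟨p', hp', q', -, rfl⟩ := (mem_langG_iff φ).1 hv
  have hx : ∀ {p : List (Letter n m)}, p ∈ langP n m → x ∉ p := fun hp hx => by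
    simpa using eq_e_or_eq_br_of_mem_langP hp hx
  have hy : ∀ {p : List (Letter n m)}, p ∈ langP n m → y ∉ p := fun hp hx => by
    simpa using eq_e_or_eq_br_of_mem_langP hp hx
  have h₁ : ([] : List (Letter n m)) ++ x :: (p' ++ y :: (q'.map t ++ [e])) =
      s ++ x :: (p ++ y :: (q.map t ++ [e]) ++ r) := by
    simpa using hsr.symm
  obtain ⟨-, -, h₂⟩ := (List.append_cons_inj_of_notMem (by simp) (by simp [hx hp'])).1 h₁
  have h₃ : p' ++ y :: (q'.map t ++ [e]) = p ++ y :: (q.map t ++ [e] ++ r) := by simpa using h₂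
  obtain ⟨rfl, -, h₄⟩ := (List.append_cons_inj_of_notMem (hy hp') (by simp)).1 h₃
  have h₅ : q'.map t ++ e :: [] = q.map t ++ e :: r := by simpa using h₄
  obtain ⟨h₆, -, -⟩ := (List.append_cons_inj_of_notMem (by simp) (by simp)).1 h₅
  rw [h₆]

end Languages

/-! ### Rewriting rules and their leading words -/

section Rules

variable {n m : ℕ} [NeZero n] (φ : FreeMonoid (Paren n) →* FreeMonoid (Fin m))

/-- The relations (i)–(iii) as rewriting rules for words of length two. -/
inductive Rule : Letter n m → Letter n m → Option (List (Letter n m)) → Prop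
  | up_a_x (i : Fin n) : Rule (up (a i) i) x (some [x, up (a i) i])
  | up_b_x : Rule (up (b 0) 0) x (some [x, e])
  | up_br (c c' : Paren n) (j : Fin n) : Rule (up c j) (br c') (some [br c, up c' j])
  | up_e (c : Paren n) (j : Fin n) : Rule (up c j) e (some [br c, br (b j)])
  | br_y (c : Paren n) :
      Rule (br c) y (some (y :: (φ (FreeMonoid.of c)).toList.map t))
  | up_y (c : Paren n) (j : Fin n) : Rule (up c j) y none

/-- The element `l l' - o` of the free algebra, where `o` is zero if undefined. -/
def ruleElt (k : Type*) [Field k] (l l' : Letter n m) (o : Option (List (Letter n m))) :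
    FreeAlg k (Letter n m) :=
  word k [l, l'] - o.elim 0 (word k)

variable {φ}

theorem Rule.unique {l l' : Letter n m} {o o' : Option (List (Letter n m))} (h : Rule φ l l' o)
    (h' : Rule φ l l' o') : o = o' := by
  cases h <;> cases h' <;> rfl

theorem Rule.left_eq {l l' : Letter n m} {o : Option (List (Letter n m))} (h : Rule φ l l' o) :
    (∃ c j, l = up c j) ∨ (∃ c, l = br c) ∧ l' = y := by
  cases h <;> simp

theorem mem_relations_iff {k : Type*} [Field k] {f : FreeAlg k (Letter n m)} :
    f ∈ relI k ∪ relII k ∪ relIII k φ ↔ ∃ l l' o, Rule φ l l' o ∧ f = ruleElt k l l' o := by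
  constructor
  · rintro (((⟨i, rfl⟩ | rfl) | (⟨c, c', j, rfl⟩ | ⟨c, j, rfl⟩)) | (⟨c, rfl⟩ | ⟨c, j, rfl⟩))
    · exact ⟨_, _, _, .up_a_x i, rfl⟩
    · exact ⟨_, _, _, .up_b_x, rfl⟩
    · exact ⟨_, _, _, .up_br c c' j, rfl⟩
    · exact ⟨_, _, _, .up_e c j, rfl⟩
    · exact ⟨_, _, _, .br_y c, rfl⟩
    · exact ⟨_, _, _, .up_y c j, by simp [ruleElt]⟩
  · rintro ⟨_, _, _, h, rfl⟩
    cases h with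
    | up_a_x i => exact Or.inl (Or.inl (Or.inl ⟨i, rfl⟩))
    | up_b_x => exact Or.inl (Or.inl (Or.inr rfl))
    | up_br c c' j => exact Or.inl (Or.inr (Or.inl ⟨c, c', j, rfl⟩))
    | up_e c j => exact Or.inl (Or.inr (Or.inr ⟨c, j, rfl⟩))
    | br_y c => exact Or.inr (Or.inl ⟨c, rfl⟩)
    | up_y c j => exact Or.inr (Or.inr ⟨c, j, by simp [ruleElt]⟩)

variable (φ) in
/-- The leading words of the GS-basis. -/
def leadWords : Set (List (Letter n m)) :=
  {w | (∃ l l' o, Rule φ l l' o ∧ w = [l, l']) ∨ w ∈ langG φ}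

/-- The left side of a rule contains some `c^j`, which is absent from `x P_n y L e`, or is `c y`,
while there `y` is preceded by `x` or `e`. -/
theorem not_infix_langG {l l' : Letter n m} {o : Option (List (Letter n m))} (h : Rule φ l l' o)
    {u : List (Letter n m)} (hu : u ∈ langG φ) : ¬ [l, l'] <:+: u := by
  rintro ⟨s, r, hsr⟩
  obtain ⟨p, hp, q, -, rfl⟩ := (mem_langG_iff φ).1 hu
  rcases h.left_eq with ⟨c, j, rfl⟩ | ⟨⟨c, rfl⟩, rfl⟩
  · have : up c j ∈ x :: p ++ y :: (q.map t ++ [e]) := by rw [← hsr]; simp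
    simp only [List.cons_append, List.mem_cons, reduceCtorEq, List.mem_append, List.mem_map,
      and_false, exists_false, List.not_mem_nil, or_false, false_or] at this
    simpa using eq_e_or_eq_br_of_mem_langP hp this
  · have hy : y ∉ x :: p := by
      intro hy
      have hy' : y ∈ p := by simpa using hy
      simpa using eq_e_or_eq_br_of_mem_langP hp hy'
    have hsr' : x :: p ++ y :: (q.map t ++ [e]) = (s ++ [br c]) ++ y :: r := by simpa using hsr.symm
    obtain ⟨hxp, -⟩ := (List.append_cons_inj_of_notMem hy (by simp)).1 hsr'
    cases s with
    | nil => simp at hxp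
    | cons d s => exact langP_ne_append_br hp s c (by simpa using (List.cons.inj hxp).2)

/-- The leading words do not contain one another. -/
theorem eq_of_infix_of_mem_leadWords {u v : List (Letter n m)} (hu : u ∈ leadWords φ)
    (hv : v ∈ leadWords φ) (h : u <:+: v) : u = v := by
  rcases hu with ⟨l, l', o, hr, rfl⟩ | hu <;> rcases hv with ⟨d, d', o', hr', rfl⟩ | hv
  · exact h.eq_of_length rfl
  · exact absurd h (not_infix_langG hr hv)
  · have hx := h.subset (x_mem_of_mem_langG hu)
    have hy := h.subset (y_mem_of_mem_langG hu)
    cases hr' <;> simp at hx hy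
  · exact eq_of_infix_of_mem_langG hu hv h

/-- The right-hand sides of the rules contain no leading words. -/
theorem Rule.not_infix {l l' : Letter n m} {r : List (Letter n m)} (h : Rule φ l l' (some r))
    {u : List (Letter n m)} (hu : u ∈ leadWords φ) : ¬ u <:+: r := by
  intro hur
  rcases hu with ⟨d, d', o, hr, rfl⟩ | hu
  · rcases hr.left_eq with ⟨c, j, rfl⟩ | ⟨⟨c, rfl⟩, rfl⟩
    · have hmem := hur.subset (List.mem_cons_self ..)
      cases h <;> first
        | (have := hur.eq_of_length rfl; simp at this)
        | (simp at hmem)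
    · have hmem := hur.subset (List.mem_cons_self ..)
      have hmem' := hur.subset (List.mem_cons_of_mem _ (List.mem_cons_self ..))
      cases h <;> simp at hmem hmem'
  · have hx := hur.subset (x_mem_of_mem_langG hu)
    have hy := hur.subset (y_mem_of_mem_langG hu)
    cases h <;> simp at hx hy

end Rules

/-! ### The normal form operators -/

section Operators

variable {n m : ℕ} (φ : FreeMonoid (Paren n) →* FreeMonoid (Fin m))

/-- Left multiplication by a parenthesis, followed by the rule `c y = y φ(c)`. -/
def opBr (c : Paren n) : List (Letter n m) → List (Letter n m)
  | y :: v => y :: ((φ (FreeMonoid.of c)).toList.map t ++ v)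
  | v => br c :: v

/-- The words with a prefix in `P_n y L e`. -/
def KilledByX (v : List (Letter n m)) : Prop :=
  ∃ p ∈ langP n m, ∃ l ∈ dyckImage φ, ∃ z, v = p ++ y :: (l.map t ++ e :: z)

open Classical in
/-- Left multiplication by `x`, followed by the rules `x P_n y L e = 0`. -/
def opX (v : List (Letter n m)) : Option (List (Letter n m)) :=
  if KilledByX φ v then none else some (x :: v)

theorem opBr_of_ne {v : List (Letter n m)} (hv : ∀ v', v ≠ y :: v') (c : Paren n) :
    opBr φ c v = br c :: v := by
  unfold opBr
  split
  · exact absurd rfl (hv _)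
  · rfl

theorem opBr_cases (c : Paren n) (v : List (Letter n m)) :
    (∃ v', v = y :: v' ∧ opBr φ c v = y :: ((φ (FreeMonoid.of c)).toList.map t ++ v')) ∨
      opBr φ c v = br c :: v := by
  by_cases h : ∃ v', v = y :: v'
  · obtain ⟨v', rfl⟩ := h
    exact Or.inl ⟨v', rfl, rfl⟩
  · exact Or.inr (opBr_of_ne φ (not_exists.1 h) c)

theorem foldr_opBr_of_ne (w : List (Paren n)) {v : List (Letter n m)} (hv : ∀ v', v ≠ y :: v') :
    w.foldr (opBr φ) v = w.map br ++ v := by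
  induction w with
  | nil => rfl
  | cons c w ih =>
    rw [List.foldr_cons, ih, opBr_of_ne]
    · rfl
    · intro v'
      cases w with
      | nil => exact hv v'
      | cons c' w => simp

theorem foldr_opBr_y (w : List (Paren n)) (v : List (Letter n m)) :
    w.foldr (opBr φ) (y :: v) = y :: ((φ (FreeMonoid.ofList w)).toList.map t ++ v) := by
  induction w with
  | nil => simp
  | cons c w ih => simp [ih, opBr, FreeMonoid.ofList_cons]

/-- Needed for `b_1^1 x = x e` on words killed by `x`; the factor `e` belongs to `D_n e` because the
empty word is Dyck. -/
theorem KilledByX.cons_e {v : List (Letter n m)} (hv : KilledByX φ v) : KilledByX φ (e :: v) := by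
  obtain ⟨p, hp, l, hl, z, rfl⟩ := hv
  exact ⟨e :: p, by simpa using cons_mem_langP IsDyck.nil hp, l, hl, z, rfl⟩

theorem opX_eq_none {v : List (Letter n m)} (hv : KilledByX φ v) : opX φ v = none := if_pos hv

theorem opX_of_not {v : List (Letter n m)} (hv : ¬ KilledByX φ v) : opX φ v = some (x :: v) :=
  if_neg hv

variable [NeZero n]

open Classical in
/-- Left multiplication by `c^j`, followed by reduction. -/
def opUp : Paren n → Fin n → List (Letter n m) → Option (List (Letter n m))
  | c, j, br c' :: v => (opUp c' j v).map (opBr φ c)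
  | c, j, e :: v => some (opBr φ c (opBr φ (b j) v))
  | _, _, y :: _ => none
  -- The relations (i) are built in here for `v` not killed by `x`: `a_j^j` passes `x` and acts on
  -- `v`, after which `x` may kill the result.
  | c, j, x :: v =>
    if c = a j then (opUp c j v).bind (opX φ)
    else if c = b 0 ∧ j = 0 then opX φ (e :: v)
    else some (up c j :: x :: v)
  | c, j, up c' j' :: v => some (up c j :: up c' j' :: v)
  | c, j, t i :: v => some (up c j :: t i :: v)
  | c, j, [] => some [up c j]

/-- Left multiplication by a letter, followed by reduction. -/
def op : Letter n m → List (Letter n m) → Option (List (Letter n m))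
  | br c, v => some (opBr φ c v)
  | up c j, v => opUp φ c j v
  | x, v => opX φ v
  | e, v => some (e :: v)
  | y, v => some (y :: v)
  | t i, v => some (t i :: v)

/-- The upper index moves right through the parentheses until it meets `e`, which becomes `b_j`. -/
theorem opUp_append_e (c : Paren n) (j : Fin n) (w : List (Paren n)) (v : List (Letter n m)) :
    opUp φ c j (w.map br ++ e :: v) = some ((c :: w ++ [b j]).foldr (opBr φ) v) := by
  induction w generalizing c with
  | nil => rfl
  | cons c' w ih =>
    rw [List.map_cons, List.cons_append, opUp, ih]
    rfl

/-- The compatibility of `a_i^i x = x a_i^i` with the killing by `x`: replacing a prefix `w e` by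
`a_i w b_i` keeps the word in the killed set. -/
theorem KilledByX.opUp_bind_opX {v : List (Letter n m)} (hv : KilledByX φ v) (i : Fin n) :
    (opUp φ (a i) i v).bind (opX φ) = none := by
  obtain ⟨p, hp, l, hl, z, rfl⟩ := hv
  rcases langP_cases hp with rfl | ⟨w, p, hw, hp', rfl⟩
  -- Here `a_i^i` meets `y` and gives zero.
  · rfl
  have hdyck : ∀ {w'}, IsDyck w' → IsDyck (a i :: w ++ b i :: w') := fun h => .cons i w _ hw h
  rw [List.append_assoc, List.cons_append, opUp_append_e, Option.bind_some]
  apply opX_eq_none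
  -- Either `a_i w b_i` reaches `y` and its image is absorbed into `L`, or it is absorbed into the
  -- next Dyck factor of `P_n`.
  rcases langP_cases hp' with rfl | ⟨w', p, hw', hp'', rfl⟩
  · rw [List.nil_append, foldr_opBr_y]
    refine ⟨[], nil_mem_langP, _, append_mem_dyckImage φ (hdyck IsDyck.nil) hl, z, ?_⟩
    simp
  · rw [foldr_opBr_of_ne]
    · exact ⟨_, cons_mem_langP (hdyck hw') hp'', l, hl, z, by simp⟩
    · intro v'
      cases w' <;> simp

theorem actWord_map_t (l : List (Fin m)) (v : List (Letter n m)) :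
    actWord (op φ) (l.map t) v = some (l.map t ++ v) := by
  induction l with
  | nil => rfl
  | cons i l ih =>
    rw [List.map_cons, actWord_cons, ih]
    rfl

/-- The operators satisfy the rules. -/
theorem Rule.actWord_eq {l l' : Letter n m} {o : Option (List (Letter n m))} (h : Rule φ l l' o)
    (v : List (Letter n m)) :
    actWord (op φ) [l, l'] v = o.elim none fun r => actWord (op φ) r v := by
  cases h with
  | up_a_x i =>
    by_cases hv : KilledByX φ v
    · simp only [actWord_cons, actWord_nil, Option.bind_some, op, opX_eq_none φ hv,
        Option.bind_none, Option.elim_some]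
      exact (hv.opUp_bind_opX φ i).symm
    · simp only [actWord_cons, actWord_nil, Option.bind_some, op, opX_of_not φ hv, opUp, if_pos,
        Option.elim_some]
      rfl
  | up_b_x =>
    by_cases hv : KilledByX φ v
    · simp [op, opX_eq_none φ hv, opX_eq_none φ (hv.cons_e φ)]
    · simp [op, opX_of_not φ hv, opUp]
  | up_br c c' j =>
    -- If `v` begins with `y`, both sides vanish.
    rcases opBr_cases φ c' v with ⟨v', rfl, hv'⟩ | hv'
    · simp [op, hv', opUp]
    · simp only [actWord_cons, actWord_nil, Option.bind_some, op, hv', opUp, Option.elim_some]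
      cases opUp φ c' j v <;> rfl
  | up_e c j => rfl
  | br_y c =>
    simp [actWord_map_t, op, opBr]
  | up_y c j => rfl

theorem actWord_x_y_e (v : List (Letter n m)) : actWord (op φ) [x, y, e] v = none :=
  opX_eq_none φ ⟨[], nil_mem_langP, [], nil_mem_dyckImage φ, v, rfl⟩

theorem opRep_eq_zero {k : Type*} [Field k] {f : FreeAlg k (Letter n m)}
    (hf : f ∈ relI k ∪ relII k ∪ relIII k φ ∪ relIV k) : opRep k (op φ) f = 0 := by
  rcases hf with hf | rfl
  · obtain ⟨l, l', o, hr, rfl⟩ := mem_relations_iff.1 hf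
    have hact := hr.actWord_eq
    cases o with
    | none => simpa [ruleElt] using opRep_word_eq_zero hact
    | some r => exact opRep_word_sub_word_eq_zero hact
  · exact opRep_word_eq_zero (actWord_x_y_e φ)

/-- The operators fix the words that contain no leading words. -/
theorem actWord_eq_self {w : List (Letter n m)} (hw : ∀ u ∈ leadWords φ, ¬ u <:+: w) :
    actWord (op φ) w [] = some w := by
  induction w with
  | nil => rfl
  | cons l v ih =>
    rw [actWord_cons, ih fun u hu h => hw u hu (h.trans (List.suffix_cons l v).isInfix),
      Option.bind_some]
    have hrule : ∀ {l' v' o}, v = l' :: v' → ¬ Rule φ l l' o := by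
      rintro l' v' o rfl hr
      exact hw [l, l'] (Or.inl ⟨l, l', o, hr, rfl⟩) ⟨[], v', rfl⟩
    cases l with
    | br c => exact congrArg some (opBr_of_ne φ (fun v' hv' => hrule hv' (.br_y c)) c)
    | up c j =>
      rcases v with _ | ⟨l', v⟩
      · rfl
      · cases l' with
        | br c' => exact absurd (.up_br c c' j) (hrule rfl)
        | up c' j' => rfl
        | x =>
          have h₁ : c ≠ a j := by
            rintro rfl
            exact hrule rfl (.up_a_x j)
          have h₂ : ¬ (c = b 0 ∧ j = 0) := by
            rintro ⟨rfl, rfl⟩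
            exact hrule rfl .up_b_x
          simp only [op, opUp, if_neg h₁, if_neg h₂]
        | e => exact absurd (.up_e c j) (hrule rfl)
        | y => exact absurd (.up_y c j) (hrule rfl)
        | t i => rfl
    | x =>
      refine opX_of_not φ ?_
      -- If `x` killed the tail, the word would begin with a word of `x P_n y L e`.
      rintro ⟨p, hp, l, hl, z, rfl⟩
      exact hw _ (Or.inr ((mem_langG_iff φ).2 ⟨p, hp, l, hl, rfl⟩)) ⟨[], z, by simp⟩
    | e => rfl
    | y => rfl
    | t i => rfl

end Operators

/-! ### The operators do not increase words in deglex order -/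

section Order

variable {n m : ℕ} {D : ℕ}

theorem wordDeg_ofList_cons (l : Letter n m) (u : List (Letter n m)) :
    wordDeg D (FreeMonoid.ofList (l :: u)) = letterDeg D l + wordDeg D (FreeMonoid.ofList u) := by
  simp [wordDeg]

theorem wordDeg_ofList_map_t_append (l : List (Fin m)) (u : List (Letter n m)) :
    wordDeg D (FreeMonoid.ofList (l.map t ++ u)) =
      l.length + wordDeg D (FreeMonoid.ofList u) := by
  induction l with
  | nil => simp
  | cons i l ih =>
    rw [List.map_cons, List.cons_append, wordDeg_ofList_cons, ih, List.length_cons, letterDeg]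
    omega

variable [LinearOrder (Letter n m)]

theorem degLex_asymm (u v : FreeMonoid (Letter n m)) (h : degLex D u v) : ¬ degLex D v u := by
  rintro (h' | ⟨h', hl'⟩) <;> rcases h with h | ⟨h, hl⟩
  · omega
  · omega
  · omega
  · exact asymm_of (List.Lex (· < ·)) hl hl'

theorem degLex_trans {u v w : FreeMonoid (Letter n m)} (h : degLex D u v) (h' : degLex D v w) :
    degLex D u w := by
  rcases h with h | ⟨h, hl⟩ <;> rcases h' with h' | ⟨h', hl'⟩
  · exact Or.inl (h.trans h')
  · exact Or.inl (h.trans_eq h')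
  · exact Or.inl (h.trans_lt h')
  · exact Or.inr ⟨h.trans h', (show u.toList < v.toList from hl).trans hl'⟩

theorem degLex_cons_of_lt {l l' : Letter n m} (h : l < l') {u v : List (Letter n m)}
    (hdeg : letterDeg D l + wordDeg D (FreeMonoid.ofList u) ≤
      letterDeg D l' + wordDeg D (FreeMonoid.ofList v)) :
    degLex D (FreeMonoid.ofList (l :: u)) (FreeMonoid.ofList (l' :: v)) := by
  rw [← wordDeg_ofList_cons, ← wordDeg_ofList_cons] at hdeg
  rcases hdeg.lt_or_eq with hdeg | hdeg
  · exact Or.inl hdeg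
  · exact Or.inr ⟨hdeg, List.Lex.rel h⟩

theorem degLex_cons (l : Letter n m) {u v : List (Letter n m)}
    (h : degLex D (FreeMonoid.ofList u) (FreeMonoid.ofList v)) :
    degLex D (FreeMonoid.ofList (l :: u)) (FreeMonoid.ofList (l :: v)) := by
  unfold degLex
  rw [wordDeg_ofList_cons, wordDeg_ofList_cons]
  rcases h with h | ⟨h, hl⟩
  · exact Or.inl (Nat.add_lt_add_left h _)
  · exact Or.inr ⟨congrArg _ h, List.Lex.cons hl⟩

variable (D) in
/-- The reflexive closure of the deglex ordering, for lists of letters. -/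
def DegLexLE (u v : List (Letter n m)) : Prop :=
  u = v ∨ degLex D (FreeMonoid.ofList u) (FreeMonoid.ofList v)

theorem DegLexLE.trans {u v w : List (Letter n m)} (h : DegLexLE D u v) (h' : DegLexLE D v w) :
    DegLexLE D u w := by
  rcases h with rfl | h
  · exact h'
  · rcases h' with rfl | h'
    · exact Or.inr h
    · exact Or.inr (degLex_trans h h')

theorem DegLexLE.cons (l : Letter n m) {u v : List (Letter n m)} (h : DegLexLE D u v) :
    DegLexLE D (l :: u) (l :: v) := by
  rcases h with rfl | h
  · exact Or.inl rfl
  · exact Or.inr (degLex_cons l h)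

variable {φ : FreeMonoid (Paren n) →* FreeMonoid (Fin m)}

theorem opX_le {u v : List (Letter n m)} (h : opX φ v = some u) : DegLexLE D u (x :: v) := by
  unfold opX at h
  split_ifs at h
  exact Or.inl (Option.some.inj h).symm

variable [NeZero n]

/-- The rules decrease words. -/
theorem Rule.degLex_append
    (hφ : ∀ c : Paren n, (φ (FreeMonoid.of c)).length ≤ D)
    (hord : ∀ u v : Letter n m, rank u < rank v → u < v)
    {l l' : Letter n m} {r : List (Letter n m)}
    (h : Rule φ l l' (some r)) (v : List (Letter n m)) :
    degLex D (FreeMonoid.ofList (r ++ v)) (FreeMonoid.ofList (l :: l' :: v)) := by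
  have hup : ∀ (c : Paren n) (j : Fin n), 6 ≤ rank (up c j : Letter n m) := by
    rintro (_ | _) _ <;> simp [rank]
  have hbr : ∀ c : Paren n, 4 ≤ rank (br c : Letter n m) ∧ rank (br c : Letter n m) ≤ 5 := by
    rintro (_ | _) <;> simp [rank]
  cases h with
  | br_y c =>
    -- The only rule that can change the degree: `D + |φ(c)| ≤ 2 D`. In case of equality the first
    -- letters decide, as `y < c`.
    refine degLex_cons_of_lt (hord _ _ ?_) ?_
    · exact (show rank y < 4 by simp [rank]).trans_le (hbr c).1
    · have hlen : (φ (FreeMonoid.of c)).toList.length ≤ D := hφ c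
      have := wordDeg_ofList_map_t_append (D := D) (φ (FreeMonoid.of c)).toList v
      rw [wordDeg_ofList_cons]
      change D + wordDeg D (FreeMonoid.ofList ((φ (FreeMonoid.of c)).toList.map t ++ v)) ≤
        D + (D + _)
      omega
  | up_a_x i | up_b_x =>
    refine degLex_cons_of_lt (hord _ _ ?_) ?_
    · simp [rank]
    · exact (congrArg _ (wordDeg_ofList_cons _ v)).trans
        (congrArg _ (wordDeg_ofList_cons _ v).symm) |>.le
  | up_br c c' j | up_e c j =>
    refine degLex_cons_of_lt (hord _ _ ?_) ?_
    · exact ((hbr c).2.trans_lt (by omega)).trans_le (hup c j)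
    · exact (congrArg _ (wordDeg_ofList_cons _ v)).trans
        (congrArg _ (wordDeg_ofList_cons _ v).symm) |>.le

theorem opBr_le
    (hφ : ∀ c : Paren n, (φ (FreeMonoid.of c)).length ≤ D)
    (hord : ∀ u v : Letter n m, rank u < rank v → u < v)
    (c : Paren n) (v : List (Letter n m)) : DegLexLE D (opBr φ c v) (br c :: v) := by
  rcases opBr_cases φ c v with ⟨v', rfl, h⟩ | h
  · rw [h]
    exact Or.inr (Rule.degLex_append hφ hord (.br_y c) v')
  · exact Or.inl h

/-- Each recursive clause applies one decreasing rule and then operators that do not increase words.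
-/
theorem opUp_le
    (hφ : ∀ c : Paren n, (φ (FreeMonoid.of c)).length ≤ D)
    (hord : ∀ u v : Letter n m, rank u < rank v → u < v)
    {c : Paren n} {j : Fin n} {u v : List (Letter n m)}
    (h : opUp φ c j v = some u) : DegLexLE D u (up c j :: v) := by
  induction v generalizing c u with
  | nil => exact Or.inl (Option.some.inj h).symm
  | cons l v ih =>
    cases l with
    | br c' =>
      obtain ⟨u', hu', rfl⟩ := Option.map_eq_some_iff.1 h
      exact ((opBr_le hφ hord c u').trans ((ih hu').cons _)).trans
        (Or.inr (Rule.degLex_append hφ hord (.up_br c c' j) v))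
    | up c' j' => exact Or.inl (Option.some.inj h).symm
    | x =>
      rw [opUp] at h
      split_ifs at h with h₁ h₂
      · subst h₁
        obtain ⟨u', hu', h⟩ := Option.bind_eq_some_iff.1 h
        exact ((opX_le h).trans ((ih hu').cons _)).trans
          (Or.inr (Rule.degLex_append hφ hord (.up_a_x j) v))
      · obtain ⟨rfl, rfl⟩ := h₂
        exact (opX_le h).trans (Or.inr (Rule.degLex_append hφ hord .up_b_x v))
      · exact Or.inl (Option.some.inj h).symm
    | e =>
      obtain rfl := Option.some.inj h
      exact ((opBr_le hφ hord c _).trans ((opBr_le hφ hord (b j) v).cons _)).trans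
        (Or.inr (Rule.degLex_append hφ hord (.up_e c j) v))
    | y => exact absurd h (by simp [opUp])
    | t i => exact Or.inl (Option.some.inj h).symm

theorem op_le
    (hφ : ∀ c : Paren n, (φ (FreeMonoid.of c)).length ≤ D)
    (hord : ∀ u v : Letter n m, rank u < rank v → u < v)
    {l : Letter n m} {u v : List (Letter n m)} (h : op φ l v = some u) :
    DegLexLE D u (l :: v) := by
  cases l with
  | br c =>
    obtain rfl := Option.some.inj h
    exact opBr_le hφ hord c v
  | up c j => exact opUp_le hφ hord h
  | x => exact opX_le h
  | e | y | t i => exact Or.inl (Option.some.inj h).symm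

theorem actWord_le
    (hφ : ∀ c : Paren n, (φ (FreeMonoid.of c)).length ≤ D)
    (hord : ∀ u v : Letter n m, rank u < rank v → u < v)
    {w v : List (Letter n m)} (h : actWord (op φ) w [] = some v) :
    DegLexLE D v w := by
  induction w generalizing v with
  | nil => exact Or.inl (Option.some.inj h).symm
  | cons l w ih =>
    obtain ⟨u, hu, h⟩ := Option.bind_eq_some_iff.1 h
    exact (op_le hφ hord h).trans ((ih hu).cons l)

end Order

/-! ### Congruence of words modulo an ideal -/

section Congruence

variable {X k : Type*} [Field k] (I : TwoSidedIdeal (FreeAlg k X))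

/-- Two words are congruent modulo `I`. -/
def WordCon (l l' : List X) : Prop := word k l - word k l' ∈ I

variable {I}

theorem WordCon.refl (l : List X) : WordCon I l l := by
  simp [WordCon, I.zero_mem]

theorem WordCon.trans {l l' l'' : List X} (h : WordCon I l l') (h' : WordCon I l' l'') :
    WordCon I l l'' := by
  simpa [WordCon] using I.add_mem h h'

theorem WordCon.append_append {l l' : List X} (h : WordCon I l l') (p q : List X) :
    WordCon I (p ++ l ++ q) (p ++ l' ++ q) := by
  have := I.mul_mem_right _ (word k q) (I.mul_mem_left (word k p) _ h)
  simpa [WordCon, word_append, mul_sub, sub_mul, mul_assoc] using this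

theorem WordCon.mem {l l' : List X} (h : WordCon I l l') (hl : word k l ∈ I) : word k l' ∈ I := by
  simpa using I.sub_mem hl h

end Congruence

/-! ### The words of `x P_n y L e` lie in the ideal -/

section Membership

variable {n m : ℕ}

/-- The words in `P_n D_n`. -/
inductive IsDyckPath : List (Letter n m) → Prop
  | nil : IsDyckPath []
  | cons_e (q : List (Letter n m)) (hq : IsDyckPath q) : IsDyckPath (e :: q)
  | cons_paren (i : Fin n) (w : List (Paren n)) (q : List (Letter n m)) (hw : IsDyck w)
      (hq : IsDyckPath q) : IsDyckPath (br (a i) :: w.map br ++ br (b i) :: q)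

theorem IsDyckPath.dyck_append {w : List (Paren n)} (hw : IsDyck w) {q : List (Letter n m)}
    (hq : IsDyckPath q) : IsDyckPath (w.map br ++ q) := by
  induction hw with
  | nil => exact hq
  | cons i w w' hw hw' _ ih' => simpa using IsDyckPath.cons_paren i w _ hw ih'

theorem isDyckPath_append {w : List (Paren n)} (hw : IsDyck w) {p : List (Letter n m)}
    (hp : p ∈ langP n m) : IsDyckPath (p ++ w.map br) := by
  refine langP_induction (motive := fun p => IsDyckPath (p ++ w.map br)) ?_ ?_ hp
  · simpa using IsDyckPath.nil.dyck_append hw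
  · intro w' p hw' _ ih
    simpa using (IsDyckPath.cons_e _ ih).dyck_append hw'

variable [NeZero n] {k : Type*} [Field k] {φ : FreeMonoid (Paren n) →* FreeMonoid (Fin m)}
  {I : TwoSidedIdeal (FreeAlg k (Letter n m))}

/-- The counterpart modulo `I` of `opUp_append_e`. -/
theorem wordCon_up_append_e
    (hI : ∀ l l' o, Rule φ l l' o → ruleElt k l l' o ∈ I) (c : Paren n) (j : Fin n)
    (w : List (Paren n)) :
    WordCon I (up c j :: w.map br ++ [e]) (br c :: w.map br ++ [br (b j)]) := by
  induction w generalizing c with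
  | nil => exact hI _ _ _ (.up_e c j)
  | cons c' w ih =>
    have h₁ : WordCon I [up c j, br c'] [br c, up c' j] := hI _ _ _ (.up_br c c' j)
    have h₂ := h₁.append_append [] (w.map br ++ [e])
    have h₃ := (ih c').append_append [br c] []
    exact WordCon.trans (by simpa using h₂) (by simpa using h₃)

theorem wordCon_append_y
    (hI : ∀ l l' o, Rule φ l l' o → ruleElt k l l' o ∈ I) (w : List (Paren n)) :
    WordCon I (w.map br ++ [y]) (y :: (φ (FreeMonoid.ofList w)).toList.map t) := by
  induction w with
  | nil => simpa using WordCon.refl _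
  | cons c w ih =>
    have h₁ : WordCon I [br c, y] (y :: (φ (FreeMonoid.of c)).toList.map t) :=
      hI _ _ _ (.br_y c)
    have h₂ := ih.append_append [br c] []
    have h₃ := h₁.append_append [] ((φ (FreeMonoid.ofList w)).toList.map t)
    exact WordCon.trans (by simpa using h₂) (by simpa [FreeMonoid.ofList_cons] using h₃)

/-- Induction on length: `e q` comes from `q` by `b_1^1`, and `a_i w b_i q` comes from the shorter
`w e q` by `a_i^i`. -/
theorem IsDyckPath.word_mem
    (hI : ∀ l l' o, Rule φ l l' o → ruleElt k l l' o ∈ I) (hI' : word k [x, y, e] ∈ I)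
    {q : List (Letter n m)} (hq : IsDyckPath q) : word k (x :: q ++ [y, e]) ∈ I := by
  induction hlen : q.length using Nat.strong_induction_on generalizing q with
  | _ N ih =>
    cases hq with
    | nil => exact hI'
    | cons_e q hq =>
      have h₁ : WordCon I [up (b 0) 0, x] [x, e] := hI _ _ _ .up_b_x
      have h₂ := h₁.append_append [] (q ++ [y, e])
      have h₃ := I.mul_mem_left (word k [up (b 0) 0]) _ (ih q.length (by simp [← hlen]) hq rfl)
      rw [← word_append] at h₃
      simpa using h₂.mem (by simpa using h₃)
    | cons_paren i w q hw hq =>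
      have h₁ : WordCon I [up (a i) i, x] [x, up (a i) i] := hI _ _ _ (.up_a_x i)
      have h₂ := h₁.append_append [] (w.map br ++ e :: q ++ [y, e])
      have h₃ := (wordCon_up_append_e hI (a i) i w).append_append [x] (q ++ [y, e])
      have h₄ := I.mul_mem_left (word k [up (a i) i]) _
        (ih (w.map br ++ e :: q).length (by simp [← hlen])
          ((IsDyckPath.cons_e q hq).dyck_append hw) rfl)
      rw [← word_append] at h₄
      have h₅ := h₂.mem (by simpa using h₄)
      simpa using h₃.mem (by simpa using h₅)

theorem word_mem_of_mem_langG
    (hI : ∀ l l' o, Rule φ l l' o → ruleElt k l l' o ∈ I) (hI' : word k [x, y, e] ∈ I)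
    {u : List (Letter n m)} (hu : u ∈ langG φ) : word k u ∈ I := by
  obtain ⟨p, hp, _, ⟨w, hw, rfl⟩, rfl⟩ := (mem_langG_iff φ).1 hu
  have h₁ := (isDyckPath_append hw hp).word_mem hI hI'
  -- The final Dyck factor `w` of `p w` crosses `y` and becomes `φ(w)`.
  have h₂ := (wordCon_append_y hI w).append_append (x :: p) [e]
  simpa using h₂.mem (by simpa using h₁)

end Membership

/-! ### Assembling the minimal reduced basis -/

section Basis

variable {n m : ℕ} [NeZero n] {k : Type*} [Field k]
  {φ : FreeMonoid (Paren n) →* FreeMonoid (Fin m)} {D : ℕ} [LinearOrder (Letter n m)]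

theorem Rule.isLeadingMonomial_iff (hφ : ∀ c : Paren n, (φ (FreeMonoid.of c)).length ≤ D)
    (hord : ∀ u v : Letter n m, rank u < rank v → u < v)
    {l l' : Letter n m} {o : Option (List (Letter n m))} (h : Rule φ l l' o)
    {w : FreeMonoid (Letter n m)} :
    IsLeadingMonomial (degLex D) (ruleElt k l l' o) w ↔ w = FreeMonoid.ofList [l, l'] := by
  cases o with
  | none =>
    rw [ruleElt, Option.elim_none, sub_zero]
    exact isLeadingMonomial_word_iff
  | some r =>
    refine isLeadingMonomial_word_sub_word_iff degLex_asymm ?_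
    simpa only [List.append_nil] using Rule.degLex_append hφ hord h []

theorem leadingMonomials_eq (hφ : ∀ c : Paren n, (φ (FreeMonoid.of c)).length ≤ D)
    (hord : ∀ u v : Letter n m, rank u < rank v → u < v) :
    leadingMonomials (degLex D) ((relI k ∪ relII k ∪ relIII k φ) ∪ word k '' langG φ) =
      FreeMonoid.ofList '' leadWords φ := by
  ext w
  constructor
  · rintro ⟨f, hf | ⟨u, hu, rfl⟩, hw⟩
    · obtain ⟨l, l', o, h, rfl⟩ := mem_relations_iff.1 hf
      exact ⟨[l, l'], Or.inl ⟨l, l', o, h, rfl⟩, ((h.isLeadingMonomial_iff hφ hord).1 hw).symm⟩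
    · exact ⟨u, Or.inr hu, (isLeadingMonomial_word_iff.1 hw).symm⟩
  · rintro ⟨u, ⟨l, l', o, h, rfl⟩ | hu, rfl⟩
    · exact ⟨ruleElt k l l' o, Or.inl (mem_relations_iff.2 ⟨l, l', o, h, rfl⟩),
        (h.isLeadingMonomial_iff hφ hord).2 rfl⟩
    · exact ⟨word k u, Or.inr ⟨u, hu, rfl⟩, isLeadingMonomial_word_iff.2 rfl⟩

theorem infix_of_ofList_eq {X : Type*} {u v : List X} {p q : FreeMonoid X}
    (h : FreeMonoid.ofList v = p * FreeMonoid.ofList u * q) : u <:+: v :=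
  ⟨p.toList, q.toList, (congrArg FreeMonoid.toList h).symm⟩

variable (k) in
theorem isGSBasis (hφ : ∀ c : Paren n, (φ (FreeMonoid.of c)).length ≤ D)
    (hord : ∀ u v : Letter n m, rank u < rank v → u < v) :
    IsGSBasis (degLex D) ((relI k ∪ relII k ∪ relIII k φ) ∪ word k '' langG φ)
      (TwoSidedIdeal.span (relI k ∪ relII k ∪ relIII k φ ∪ relIV k)) := by
  refine IsGSBasis.of_exists_subword ?_ ?_
  · rintro f (hf | ⟨u, hu, rfl⟩)
    · exact TwoSidedIdeal.subset_span (Or.inl hf)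
    · exact word_mem_of_mem_langG (fun l l' o h => TwoSidedIdeal.subset_span
        (Or.inl (mem_relations_iff.2 ⟨l, l', o, h, rfl⟩)))
        (TwoSidedIdeal.subset_span (Or.inr rfl)) hu
  · intro f hf w hw
    rw [leadingMonomials_eq hφ hord]
    by_contra! h
    -- A word without leading subwords is fixed by the operators, which is impossible for a leading
    -- monomial of the ideal.
    refine actWord_ne_of_isLeadingMonomial degLex_asymm
      (fun w v hv => actWord_le hφ hord hv) (fun f => opRep_eq_zero φ) hf hw
      (actWord_eq_self φ ?_)
    rintro u hu ⟨p, q, hpq⟩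
    exact h _ ⟨u, hu, rfl⟩ (FreeMonoid.ofList p) (FreeMonoid.ofList q)
      (congrArg FreeMonoid.ofList hpq).symm

variable (k) in
theorem isMinimalGSBasis (hφ : ∀ c : Paren n, (φ (FreeMonoid.of c)).length ≤ D)
    (hord : ∀ u v : Letter n m, rank u < rank v → u < v) :
    IsMinimalGSBasis (degLex D) ((relI k ∪ relII k ∪ relIII k φ) ∪ word k '' langG φ)
      (TwoSidedIdeal.span (relI k ∪ relII k ∪ relIII k φ ∪ relIV k)) where
  toIsGSBasis := isGSBasis k hφ hord
  minimal W hW := by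
    refine (isGSBasis k hφ hord).monomialIdeal_ne_of_ssubset ?_ hW
    rw [leadingMonomials_eq hφ hord]
    rintro _ ⟨u, hu, rfl⟩ _ ⟨v, hv, rfl⟩ p q h
    exact congrArg _ (eq_of_infix_of_mem_leadWords hu hv (infix_of_ofList_eq h))
  zero_notMem := by
    have hzero : ∀ w, ¬ IsLeadingMonomial (degLex D) (0 : FreeAlg k (Letter n m)) w :=
      fun w hw => hw.1 (by simp)
    rintro (h | ⟨u, -, h⟩)
    · obtain ⟨l, l', o, hr, h⟩ := mem_relations_iff.1 h
      exact hzero _ (h ▸ (hr.isLeadingMonomial_iff hφ hord).2 rfl)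
    · exact hzero _ (h ▸ isLeadingMonomial_word_iff.2 rfl)
  injective := by
    have hne : ∀ {l l' : Letter n m} {o}, Rule φ l l' o → ∀ {u}, u ∈ langG φ →
        ∀ {w : FreeMonoid (Letter n m)}, w = FreeMonoid.ofList [l, l'] →
          w ≠ FreeMonoid.ofList u := by
      intro l l' o h u hu w hw hw'
      have : [l, l'] = u := FreeMonoid.ofList.injective (hw.symm.trans hw')
      exact not_infix_langG h hu (this ▸ List.infix_rfl)
    rintro f (hf | ⟨u, hu, rfl⟩) g (hg | ⟨v, hv, rfl⟩) w hfw hgw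
    · obtain ⟨l, l', o, h, rfl⟩ := mem_relations_iff.1 hf
      obtain ⟨d, d', o', h', rfl⟩ := mem_relations_iff.1 hg
      have heq : [l, l'] = [d, d'] := FreeMonoid.ofList.injective
        (((h.isLeadingMonomial_iff hφ hord).1 hfw).symm.trans
          ((h'.isLeadingMonomial_iff hφ hord).1 hgw))
      obtain ⟨rfl, rfl⟩ : l = d ∧ l' = d' := by simpa using heq
      rw [h.unique h']
    · obtain ⟨l, l', o, h, rfl⟩ := mem_relations_iff.1 hf
      exact absurd (isLeadingMonomial_word_iff.1 hgw)
        (hne h hv ((h.isLeadingMonomial_iff hφ hord).1 hfw))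
    · obtain ⟨l, l', o, h, rfl⟩ := mem_relations_iff.1 hg
      exact absurd (isLeadingMonomial_word_iff.1 hfw)
        (hne h hu ((h.isLeadingMonomial_iff hφ hord).1 hgw))
    · exact congrArg _ (FreeMonoid.ofList.injective
        ((isLeadingMonomial_word_iff.1 hfw).symm.trans (isLeadingMonomial_word_iff.1 hgw)))

variable (k) in
theorem isReduced (hφ : ∀ c : Paren n, (φ (FreeMonoid.of c)).length ≤ D)
    (hord : ∀ u v : Letter n m, rank u < rank v → u < v) :
    IsReduced (degLex D) ((relI k ∪ relII k ∪ relIII k φ) ∪ word k '' langG φ) := by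
  classical
  have hword : ∀ (l : List (Letter n m)) w, w = FreeMonoid.ofList l →
      (word k l).coeff w = 1 ∧ ∀ v, (word k l).coeff v ≠ 0 → v ≠ w →
        ∀ u ∈ leadingMonomials (degLex D) ((relI k ∪ relII k ∪ relIII k φ) ∪ word k '' langG φ),
          ∀ p q, v ≠ p * u * q := by
    intro l w hw
    rw [hw]
    refine ⟨by simp [coeff_word], fun v hv hne => absurd (by_contra fun h => hv ?_) hne⟩
    rw [coeff_word, if_neg (Ne.symm h)]
  rintro f (hf | ⟨u, hu, rfl⟩) w hw
  · obtain ⟨l, l', o, h, rfl⟩ := mem_relations_iff.1 hf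
    have hw' := (h.isLeadingMonomial_iff hφ hord).1 hw
    cases o with
    | none =>
      rw [ruleElt, Option.elim_none, sub_zero]
      exact hword _ _ hw'
    | some r =>
      rw [leadingMonomials_eq hφ hord, hw']
      refine ⟨coeff_word_sub_word_eq_one ?_, ?_⟩
      · rintro rfl
        exact h.not_infix (Or.inl ⟨l, l', _, h, rfl⟩) List.infix_rfl
      · rintro v hv hne _ ⟨u, hu, rfl⟩ p q hpq
        have hvr := (eq_or_eq_of_coeff_word_sub_word_ne_zero hv).resolve_left hne
        exact h.not_infix hu (infix_of_ofList_eq (hvr.symm.trans hpq))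
  · exact hword _ _ (isLeadingMonomial_word_iff.1 hw)

variable (k) in
theorem disjoint_relations_langG (hφ : ∀ c : Paren n, (φ (FreeMonoid.of c)).length ≤ D)
    (hord : ∀ u v : Letter n m, rank u < rank v → u < v) :
    Disjoint (relI k ∪ relII k ∪ relIII k φ) (word k '' langG φ) := by
  rw [Set.disjoint_left]
  rintro _ hf ⟨u, hu, rfl⟩
  obtain ⟨l, l', o, h, heq⟩ := mem_relations_iff.1 hf
  have hw := (h.isLeadingMonomial_iff (k := k) hφ hord).2 rfl
  rw [← heq, isLeadingMonomial_word_iff] at hw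
  have : [l, l'] = u := FreeMonoid.ofList.injective hw
  exact not_infix_langG h hu (this ▸ List.infix_rfl)

end Basis

end GSDyck

end

open GSDyck in
theorem mainTheorem1 (k : Type*) [Field k] (n m : ℕ) [NeZero n]
    (φ : FreeMonoid (Paren n) →* FreeMonoid (Fin m))
    (D : ℕ) (hD : 0 < D) (hφ : ∀ c : Paren n, (φ (FreeMonoid.of c)).length ≤ D)
    [LinearOrder (Letter n m)] (hord : ∀ u v : Letter n m, rank u < rank v → u < v) :
    IsMinimalGSBasis (degLex D)
      ((relI k ∪ relII k ∪ relIII k φ) ∪ word k '' langG φ)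
      (TwoSidedIdeal.span (relI k ∪ relII k ∪ relIII k φ ∪ relIV k)) ∧
    IsReduced (degLex D)
      ((relI k ∪ relII k ∪ relIII k φ) ∪ word k '' langG φ) ∧
    Disjoint (relI k ∪ relII k ∪ relIII k φ) (word k '' langG φ) ∧
    Set.Infinite (word k '' langG φ) ∧
    langP n m = explicitP n m :=
  ⟨isMinimalGSBasis k hφ hord, isReduced k hφ hord, disjoint_relations_langG k hφ hord,
    (infinite_langG φ).image word_injective.injOn, langP_eq_explicitP⟩
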